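/- Let $K$ be an infinite field, let $1\le p<n$ and $d\ge 1$ be integers, and let $I\subseteq K[x_1,\dots,x_n]$ be an ideal. Write $[\sum_k a_kt^k]_+$ for the series $\sum_k a_kt^k$ truncated at its first non-positive coefficient. The Hilbert series of $K[x_1,\dots,x_n]/I$ is $$H=\sum_{s\ge 0}(h_s-h_{s-1})\,t^s,\qquad h_s=\dim_K\bigl(K[x_1,\dots,x_n]_{\le s}/I_{\le s}\bigr),\quad h_{-1}=0,$$ which is also the Hilbert series of the associated graded algebra $K[x_1,\dots,x_n]/I^{\mathrm{top}}$, where $I^{\mathrm{top}}$ is the ideal generated by the highest-degree homogeneous components of the elements of $I$ (so $I^{\mathrm{top}}=I$ if $I$ is homogeneous). For $e\ge 1$ let $HQ_e$ be the Hilbert series of $K[x_1,\dots,x_n]/(I^{\mathrm{top}}+\langle x_n^e\rangle)$. Assume that $I$ is a generic determinantal ideal with parameters $p,d$, that is: 1. $I$ is in shape position: for the lexicographic order with $x_n$ as the least variable it has a Gröbner basis of the form $\{x_1-g_1(x_n),\dots,x_{n-1}-g_{n-1}(x_n),g_n(x_n)\}$ with $g_n$ monic; 2. $$H=\frac{\det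 P(t^{d-1})}{t^{(d-1)\binom{p-1}{2}}}\cdot\frac{(1-t^d)^p(1-t^{d-1})^{n-p}}{(1-t)^n},$$ where $P(t)$ is the $(p-1)\times(p-1)$ matrix with $(i,j)$-th entry $\sum_k\binom{p-i}{k}\binom{n-1-j}{k}t^k$; 3. (the conclusion of Fröberg's conjecture) $HQ_e=[(1-t^e)H]_+$ for all $e\ge 1$. Let $E$ be the staircase of $I$ for the degree reverse lexicographic order with $x_n$ as the least variable, that is, the set of monomials that are not divisible by the leading monomial of any nonzero element of $I$ (equivalently, of any element of the reduced Gröbner basis of $I$). Its elements form a basis of $K[x_1,\dots,x_n]/I$. Let $M_n$ be the matrix, in this basis, of the multiplication by $x_n$ on $K[x_1,\dots,x_n]/I$. Its column indexed by $b\in E$ is called trivial if $x_nb\in E$ (the column is then the unit vector with entry $1$ in the row indexed by $x_nb$), and non-trivial otherwise. Then $E$ is finite, and the number of non-trivial columns of $M_n$ is equal to the largest coefficient of $H$. -/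

import Mathlib

open scoped MonomialOrder

noncomputable section

namespace DetIdeal

/-! ### The degree reverse lexicographic order -/

/-- Exponent vectors in `n` variables, to be ordered by the degree reverse lexicographic order. -/
@[ext] structure DRL (n : ℕ) where
  /-- the underlying exponent vector -/
  exp : Fin n →₀ ℕ

namespace DRL

variable {n : ℕ}

/-- A type synonym wrapper, as an equivalence. -/
def equiv (n : ℕ) : DRL n ≃ (Fin n →₀ ℕ) where
  toFun a := a.exp
  invFun a := ⟨a⟩
  left_inv _ := rfl
  right_inv _ := rfl

instance : AddCommMonoid (DRL n) := (equiv n).addCommMonoid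

theorem exp_add (a b : DRL n) : (a + b).exp = a.exp + b.exp := rfl

/-- Compare total degrees first; among monomials of equal degree, the bigger one in the
colexicographic order is the smaller one. See `drl_lt_iff` for the explicit description. -/
def key (a : DRL n) : ℕ ×ₗ (Colex (Fin n →₀ ℕ))ᵒᵈ :=
  toLex (a.exp.degree, OrderDual.toDual (toColex a.exp))

theorem key_injective : Function.Injective (key (n := n)) := by
  intro a b h
  have h2 := congrArg (fun x => ofColex (OrderDual.ofDual (ofLex x).2)) h
  exact DRL.ext h2

instance : LinearOrder (DRL n) := LinearOrder.lift' key key_injective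

theorem le_iff (a b : DRL n) : a ≤ b ↔ a.exp.degree < b.exp.degree ∨
    (a.exp.degree = b.exp.degree ∧ toColex b.exp ≤ toColex a.exp) := by
  change key a ≤ key b ↔ _
  rw [key, key, Prod.Lex.toLex_le_toLex]
  rfl

theorem lt_iff (a b : DRL n) : a < b ↔ a.exp.degree < b.exp.degree ∨
    (a.exp.degree = b.exp.degree ∧ toColex b.exp < toColex a.exp) := by
  change key a < key b ↔ _
  rw [key, key, Prod.Lex.toLex_lt_toLex]
  rfl

instance : IsOrderedAddMonoid (DRL n) where
  add_le_add_left a b h c := by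
    rw [le_iff] at h ⊢
    simpa [exp_add, map_add, toColex_add] using h

theorem toSyn_monotone : Monotone (equiv n).symm := by
  intro a b h
  rw [le_iff]
  change a.degree < b.degree ∨ (a.degree = b.degree ∧ toColex b ≤ toColex a)
  obtain ⟨c, rfl⟩ := exists_add_of_le h
  rcases Nat.eq_zero_or_pos c.degree with hc | hc
  · rw [Finsupp.degree_eq_zero_iff] at hc
    subst hc
    simp
  · left
    rw [map_add]
    omega

instance : WellFoundedLT (DRL n) := by
  have : WellQuasiOrderedLE (Fin n →₀ ℕ) := inferInstance
  have := toSyn_monotone.wellQuasiOrderedLE_of_wellQuasiOrderedLE_of_surjective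
    (equiv n).symm.surjective
  infer_instance

end DRL

/-- The degree reverse lexicographic order on the monomials in `n` variables, with
`x_1 > x_2 > ... > x_n`, so that the last variable is the least one. -/
def drl (n : ℕ) : MonomialOrder (Fin n) where
  syn := DRL n
  toSyn := { toEquiv := (DRL.equiv n).symm, map_add' := fun _ _ => rfl }
  toSyn_monotone := DRL.toSyn_monotone

/-- Explicit description: `a` is smaller than `b` if and only if it has smaller degree, or the
degrees agree and, at the last index where the exponents differ, `a` has the bigger exponent. -/
theorem drl_lt_iff {n : ℕ} (a b : Fin n →₀ ℕ) :
    a ≺[drl n] b ↔ a.degree < b.degree ∨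
      (a.degree = b.degree ∧ ∃ i, (∀ j, i < j → a j = b j) ∧ b i < a i) := by
  refine (DRL.lt_iff _ _).trans ?_
  change a.degree < b.degree ∨ (a.degree = b.degree ∧ toColex b < toColex a) ↔ _
  rw [Finsupp.Colex.lt_iff]
  simp only [ofColex_toColex, eq_comm]

/-! ### Gröbner bases, staircase, multiplication matrix -/

variable {K : Type*} [Field K]

/-- `G` is a Gröbner basis of `I`: it lies in `I`, and the leading monomial of every nonzero
element of `I` is divisible by the leading monomial of a nonzero element of `G`. -/
def IsGroebnerBasis {σ : Type*} (m : MonomialOrder σ) (G : Set (MvPolynomial σ K))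
    (I : Ideal (MvPolynomial σ K)) : Prop :=
  G ⊆ I ∧ ∀ f ∈ I, f ≠ 0 → ∃ g ∈ G, g ≠ 0 ∧ m.degree g ≤ m.degree f

/-- The DRL staircase of `I`: the (exponents of) monomials which are not divisible by the
leading monomial of any nonzero element of `I`. -/
def staircase {n : ℕ} (I : Ideal (MvPolynomial (Fin n) K)) : Set (Fin n →₀ ℕ) :=
  {a | ∀ f ∈ I, f ≠ 0 → ¬ (drl n).degree f ≤ a}

/-- The staircase can be read off from any Gröbner basis, in particular the reduced one. -/
theorem staircase_eq {n : ℕ} {I : Ideal (MvPolynomial (Fin n) K)}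
    {G : Set (MvPolynomial (Fin n) K)} (hG : IsGroebnerBasis (drl n) G I) :
    staircase I = {a | ∀ g ∈ G, g ≠ 0 → ¬ (drl n).degree g ≤ a} := by
  ext a
  refine ⟨fun h g hg h0 => h g (hG.1 hg) h0, fun h f hf h0 hle => ?_⟩
  obtain ⟨g, hg, hg0, hgf⟩ := hG.2 f hf h0
  exact h g hg hg0 (hgf.trans hle)

theorem staircase_linearIndependent {n : ℕ} (I : Ideal (MvPolynomial (Fin n) K)) :
    LinearIndependent K (fun a : staircase I =>
      Ideal.Quotient.mk I (MvPolynomial.monomial (a : Fin n →₀ ℕ) (1 : K))) := by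
  rw [linearIndependent_iff]
  intro l hl
  by_contra hne
  set f : MvPolynomial (Fin n) K :=
    l.sum fun a c => MvPolynomial.monomial (a : Fin n →₀ ℕ) c with hf
  have hcoeff : ∀ a : staircase I, MvPolynomial.coeff (a : Fin n →₀ ℕ) f = l a := by
    intro a
    classical
    rw [hf, Finsupp.sum, MvPolynomial.coeff_sum]
    simp only [MvPolynomial.coeff_monomial, Subtype.coe_inj]
    rw [Finset.sum_ite_eq' l.support a]
    split_ifs with h
    · rfl
    · exact (Finsupp.notMem_support_iff.mp h).symm
  have hcoeff' : ∀ a : Fin n →₀ ℕ, a ∉ staircase I → MvPolynomial.coeff a f = 0 := by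
    intro a ha
    classical
    rw [hf, Finsupp.sum, MvPolynomial.coeff_sum]
    refine Finset.sum_eq_zero fun b _ => ?_
    rw [MvPolynomial.coeff_monomial, if_neg]
    rintro rfl
    exact ha b.2
  have hfI : f ∈ I := by
    rw [← Ideal.Quotient.eq_zero_iff_mem, hf, Finsupp.sum, map_sum, ← hl,
      Finsupp.linearCombination_apply, Finsupp.sum]
    refine Finset.sum_congr rfl fun a _ => ?_
    rw [← mul_one (l a), ← smul_eq_mul, ← MvPolynomial.smul_monomial, smul_eq_mul, mul_one]
    rfl
  have hf0 : f ≠ 0 := by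
    obtain ⟨a, ha⟩ := Finsupp.ne_iff.mp hne
    intro h0
    apply ha
    rw [← hcoeff a, h0]
    simp
  have hmem : (drl n).degree f ∈ staircase I := by
    by_contra h
    exact (MonomialOrder.coeff_degree_ne_zero_iff (m := drl n)).mpr hf0 (hcoeff' _ h)
  exact hmem f hfI hf0 le_rfl

theorem staircase_span {n : ℕ} (I : Ideal (MvPolynomial (Fin n) K)) :
    ⊤ ≤ Submodule.span K (Set.range (fun a : staircase I =>
      Ideal.Quotient.mk I (MvPolynomial.monomial (a : Fin n →₀ ℕ) (1 : K)))) := by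
  intro x _
  obtain ⟨f, rfl⟩ := Ideal.Quotient.mk_surjective x
  obtain ⟨g, r, hfr, -, hr⟩ := (drl n).div_set (B := {f | f ∈ I ∧ f ≠ 0})
    (fun b hb => isUnit_iff_ne_zero.mpr ((drl n).leadingCoeff_ne_zero_iff.mpr hb.2)) f
  have hmk : Ideal.Quotient.mk I f = Ideal.Quotient.mk I r := by
    rw [Ideal.Quotient.eq, hfr, add_sub_cancel_right, Finsupp.linearCombination_apply]
    exact Ideal.sum_mem _ fun b _ => I.mul_mem_left _ b.2.1
  rw [hmk, MvPolynomial.as_sum r, map_sum]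
  refine Submodule.sum_mem _ fun a ha => ?_
  have haE : a ∈ staircase I := fun b hb hb0 => hr a ha b ⟨hb, hb0⟩
  have : Ideal.Quotient.mk I (MvPolynomial.monomial a (MvPolynomial.coeff a r)) =
      (MvPolynomial.coeff a r) • Ideal.Quotient.mk I (MvPolynomial.monomial a (1 : K)) := by
    rw [← mul_one (MvPolynomial.coeff a r), ← smul_eq_mul, ← MvPolynomial.smul_monomial,
      smul_eq_mul, mul_one]
    rfl
  rw [this]
  exact Submodule.smul_mem _ _ (Submodule.subset_span ⟨⟨a, haE⟩, rfl⟩)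

/-- The monomials of the staircase form a basis of the quotient algebra. -/
def staircaseBasis {n : ℕ} (I : Ideal (MvPolynomial (Fin n) K)) :
    Module.Basis (staircase I) K (MvPolynomial (Fin n) K ⧸ I) :=
  Module.Basis.mk (staircase_linearIndependent I) (staircase_span I)

/-! From here on the number of variables is `N + 1`, and the last variable `x_n` is
`MvPolynomial.X (Fin.last N)`. -/

/-- The matrix `M_n` of the multiplication by the last variable on the quotient algebra, in the
basis given by the staircase: the column indexed by `b` holds the coordinates of `x_n b`. -/
def multMatrix {N : ℕ} (I : Ideal (MvPolynomial (Fin (N + 1)) K)) :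
    Matrix (staircase I) (staircase I) K := fun r b =>
  (staircaseBasis I).repr
    (Ideal.Quotient.mk I (MvPolynomial.X (Fin.last N)) * staircaseBasis I b) r

/-- The column of `M_n` indexed by `b` is trivial if `x_n b` is again in the staircase, so that
the column is the unit vector with its entry `1` in the row indexed by `x_n b`. -/
def IsTrivialColumn {N : ℕ} (I : Ideal (MvPolynomial (Fin (N + 1)) K)) (b : staircase I) : Prop :=
  ∃ c : staircase I, (c : Fin (N + 1) →₀ ℕ) = (b : Fin (N + 1) →₀ ℕ) + Finsupp.single (Fin.last N) 1 ∧
    ∀ r, multMatrix I r b = Finsupp.single c (1 : K) r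

/-! ### Hilbert series -/

/-- The (affine) Hilbert function: the dimension of the image in the quotient algebra of the
space of polynomials of total degree at most `s`. -/
def hilbertFunction {n : ℕ} (I : Ideal (MvPolynomial (Fin n) K)) (s : ℕ) : ℕ :=
  Module.finrank K (Submodule.map (Ideal.Quotient.mkₐ K I).toLinearMap
    (MvPolynomial.restrictTotalDegree (Fin n) K s))

/-- The Hilbert series of the quotient algebra filtered by degree: the coefficient of `t ^ s` is
the dimension of the degree `s` part of the associated graded algebra. -/
def hilbertSeries {n : ℕ} (I : Ideal (MvPolynomial (Fin n) K)) : PowerSeries ℤ :=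
  PowerSeries.mk fun s =>
    (hilbertFunction I s : ℤ) - if s = 0 then 0 else (hilbertFunction I (s - 1) : ℤ)

/-- The homogeneous ideal generated by the highest-degree homogeneous components of the elements
of `I`; the quotient by it is the associated graded algebra of the quotient by `I`. -/
def topIdeal {n : ℕ} (I : Ideal (MvPolynomial (Fin n) K)) : Ideal (MvPolynomial (Fin n) K) :=
  Ideal.span ((fun f => MvPolynomial.homogeneousComponent f.totalDegree f) '' (I : Set _))

/-- `HQ_e`, the Hilbert series of the quotient of the (associated graded) algebra of `I` by the
`e`-th power of the last variable. -/
def hilbertSeriesQuot {N : ℕ} (I : Ideal (MvPolynomial (Fin (N + 1)) K)) (e : ℕ) :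
    PowerSeries ℤ :=
  hilbertSeries (topIdeal I ⊔ Ideal.span {MvPolynomial.X (Fin.last N) ^ e})

open Classical in
/-- The truncation `[S]_+` of a series at its first non-positive coefficient. -/
def truncPos (S : PowerSeries ℤ) : PowerSeries ℤ :=
  PowerSeries.mk fun k =>
    if ∀ j ≤ k, 0 < PowerSeries.coeff j S then PowerSeries.coeff k S else 0

/-- The `(p-1) × (p-1)` matrix `P(s)` with `(i,j)`-th entry
`∑_k binom(p-i, k) binom(n-1-j, k) s^k`, for `1 ≤ i, j ≤ p-1`. -/
def matrixP (n p : ℕ) (s : PowerSeries ℤ) : Matrix (Fin (p - 1)) (Fin (p - 1)) (PowerSeries ℤ) :=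
  fun i j => ∑ k ∈ Finset.range (p + 1),
    ((((p - (i + 1)).choose k * (n - 1 - (j + 1)).choose k : ℕ)) : PowerSeries ℤ) * s ^ k

/-- `H = det P(t^(d-1)) / t^((d-1) binom(p-1,2)) * (1-t^d)^p (1-t^(d-1))^(n-p) / (1-t)^n`,
written without denominators (these are nonzero elements of the domain `ℤ⟦t⟧`). -/
def IsDeterminantalSeries (n p d : ℕ) (H : PowerSeries ℤ) : Prop :=
  H * (PowerSeries.X ^ ((d - 1) * (p - 1).choose 2) * (1 - PowerSeries.X) ^ n) =
    (matrixP n p (PowerSeries.X ^ (d - 1))).det *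
      ((1 - PowerSeries.X ^ d) ^ p * (1 - PowerSeries.X ^ (d - 1)) ^ (n - p))

/-! ### Generic determinantal ideals -/

/-- Shape position: for the lexicographic order with the last variable as the least one, `I` has
a Gröbner basis `{x_1 - g_1(x_n), ..., x_{n-1} - g_{n-1}(x_n), g_n(x_n)}`, with `g_n` monic. -/
def IsShapePosition {N : ℕ} (I : Ideal (MvPolynomial (Fin (N + 1)) K)) : Prop :=
  ∃ (g : Fin N → Polynomial K) (q : Polynomial K), q.Monic ∧
    IsGroebnerBasis MonomialOrder.lex
      (Set.range (fun i : Fin N => (MvPolynomial.X i.castSucc -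
          Polynomial.aeval (MvPolynomial.X (Fin.last N)) (g i) :
            MvPolynomial (Fin (N + 1)) K)) ∪
        {Polynomial.aeval (MvPolynomial.X (Fin.last N)) q}) I

/-- Generic determinantal ideals with parameters `p` and `d`, in `N + 1` variables. -/
structure IsGenericDeterminantal {N : ℕ} (p d : ℕ)
    (I : Ideal (MvPolynomial (Fin (N + 1)) K)) : Prop where
  shape : IsShapePosition I
  hilbert : IsDeterminantalSeries (N + 1) p d (hilbertSeries I)
  froberg : ∀ e : ℕ, 1 ≤ e →
    hilbertSeriesQuot I e = truncPos ((1 - PowerSeries.X ^ e) * hilbertSeries I)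

end DetIdeal

end

namespace DetIdeal

open MvPolynomial

section

variable {K : Type*} [Field K]

/-! ### Leading monomials for the degree reverse lexicographic order -/

/-! The count of non-trivial columns is the value at `t = 1` of `HQ_1`, and Fröberg's condition
turns this value into the peak of `H`.

Shape position makes the quotient a finite `K`-algebra, so `E` is finite. Multiplication by `x_n`
matches the trivial columns with the elements of `E` divisible by `x_n`; hence there are as many
non-trivial columns as elements of `E` free of `x_n` (`ncard_not_isTrivialColumn`). Because the
order is DRL with `x_n` last, these elements form the staircase of `I^top + ⟨x_n⟩`
(`staircase_topIdeal_sup_X`). Counting them by degree gives the sum of the coefficients `q_k` of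
`HQ_1`.

Let `h_k` now denote the coefficients of `H`, and let `m` be the first index with `h_m - h_{m-1} ≤
0`. Condition 3 for `e = 1` says that `q_k = h_k - h_{k-1}` for `k < m` and `q_k = 0` afterwards, so
the sum telescopes to `h_{m-1}`. Before `m` the sequence `h` increases. From `m` on it cannot rise
again: dividing by `x_n` gives `h_k ≤ h_{k-1} + q_k = h_{k-1}` (`ncard_staircase_degree_succ_le`).
So `h_{m-1}` is the maximum (`isGreatest_sum_of_truncated_differences`). -/

theorem degree_le_of_drl_le {n : ℕ} {a b : Fin n →₀ ℕ} (h : a ≼[drl n] b) :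
    a.degree ≤ b.degree := by
  by_contra! hlt
  exact absurd h (not_le.mpr ((drl_lt_iff b a).mpr (Or.inl hlt)))

/-- Among monomials of equal degree, those divisible by the last variable are smaller than those
which are not. -/
theorem drl_lt_of_last {N : ℕ} {a b : Fin (N + 1) →₀ ℕ} (hdeg : a.degree = b.degree)
    (ha : a (Fin.last N) ≠ 0) (hb : b (Fin.last N) = 0) : a ≺[drl (N + 1)] b := by
  refine (drl_lt_iff a b).mpr (Or.inr ⟨hdeg, Fin.last N, fun j hj => ?_, by omega⟩)
  exact absurd hj (Fin.le_last j).not_gt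

theorem degree_eq_of_forall_le {σ : Type*} (m : MonomialOrder σ) {f : MvPolynomial σ K}
    {a : σ →₀ ℕ} (ha : coeff a f ≠ 0) (h : ∀ b, coeff b f ≠ 0 → b ≼[m] a) : m.degree f = a := by
  refine m.toSyn.injective (le_antisymm ?_ (m.le_degree (mem_support_iff.mpr ha)))
  exact MonomialOrder.degree_le_iff.mpr fun b hb => h b (mem_support_iff.mp hb)

theorem totalDegree_eq_degree_drl {n : ℕ} (f : MvPolynomial (Fin n) K) :
    f.totalDegree = ((drl n).degree f).degree := by
  by_cases hf : f = 0
  · simp [hf]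
  refine le_antisymm ?_ ?_
  · refine Finset.sup_le fun b hb => ?_
    exact degree_le_of_drl_le ((drl n).le_degree hb)
  · exact le_totalDegree ((drl n).degree_mem_support hf)

/-! ### The staircase and the Hilbert function -/

theorem staircase_mem_of_le {n : ℕ} {I : Ideal (MvPolynomial (Fin n) K)} {a b : Fin n →₀ ℕ}
    (hb : b ∈ staircase I) (h : a ≤ b) : a ∈ staircase I :=
  fun f hf hf0 hle => hb f hf hf0 (hle.trans h)

theorem staircaseBasis_apply {n : ℕ} (I : Ideal (MvPolynomial (Fin n) K)) (a : staircase I) :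
    staircaseBasis I a = Ideal.Quotient.mk I (monomial (a : Fin n →₀ ℕ) (1 : K)) := by
  simp [staircaseBasis]

/-- Division by the nonzero elements of `I` does not raise the DRL leading monomial, and DRL
compares total degrees first, so the remainder keeps the degree bound. -/
theorem mk_mem_span_staircase {n : ℕ} (I : Ideal (MvPolynomial (Fin n) K))
    {f : MvPolynomial (Fin n) K} {s : ℕ} (hf : f.totalDegree ≤ s) :
    Ideal.Quotient.mk I f ∈ Submodule.span K (Set.range
      (fun a : {a : staircase I // (a : Fin n →₀ ℕ).degree ≤ s} => staircaseBasis I a)) := by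
  obtain ⟨g, r, hfr, hg, hr⟩ := (drl n).div_set (B := {f | f ∈ I ∧ f ≠ 0})
    (fun b hb => isUnit_iff_ne_zero.mpr ((drl n).leadingCoeff_ne_zero_iff.mpr hb.2)) f
  have hmk : Ideal.Quotient.mk I f = Ideal.Quotient.mk I r := by
    rw [Ideal.Quotient.eq, hfr, add_sub_cancel_right, Finsupp.linearCombination_apply]
    exact Ideal.sum_mem _ fun b _ => I.mul_mem_left _ b.2.1
  have hrdeg : (drl n).degree r ≼[drl n] (drl n).degree f := by
    refine MonomialOrder.degree_le_iff.mpr fun c hc => ?_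
    rw [eq_sub_of_add_eq' hfr.symm] at hc
    by_contra! hlt
    refine mem_support_iff.mp hc ?_
    rw [coeff_sub, (drl n).coeff_eq_zero_of_lt hlt, Finsupp.linearCombination_apply,
      Finsupp.sum, coeff_sum, zero_sub, neg_eq_zero]
    refine Finset.sum_eq_zero fun b _ => ?_
    refine (drl n).coeff_eq_zero_of_lt (lt_of_le_of_lt ?_ hlt)
    rw [smul_eq_mul, mul_comm]
    exact hg b
  rw [hmk, MvPolynomial.as_sum r, map_sum]
  refine Submodule.sum_mem _ fun a ha => ?_
  have haE : a ∈ staircase I := fun b hb hb0 => hr a ha b ⟨hb, hb0⟩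
  have has : a.degree ≤ s :=
    (degree_le_of_drl_le (((drl n).le_degree ha).trans hrdeg)).trans
      ((totalDegree_eq_degree_drl f).symm.le.trans hf)
  have : Ideal.Quotient.mk I (monomial a (coeff a r)) =
      (coeff a r) • staircaseBasis I ⟨a, haE⟩ := by
    rw [staircaseBasis_apply, ← mul_one (coeff a r), ← smul_eq_mul, ← smul_monomial,
      smul_eq_mul, mul_one]
    rfl
  rw [this]
  exact Submodule.smul_mem _ _ (Submodule.subset_span ⟨⟨⟨a, haE⟩, has⟩, rfl⟩)

/-- The Hilbert function counts the monomials of bounded degree in the staircase. -/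
theorem hilbertFunction_eq_ncard {n : ℕ} (I : Ideal (MvPolynomial (Fin n) K)) (s : ℕ) :
    hilbertFunction I s = {a | a ∈ staircase I ∧ a.degree ≤ s}.ncard := by
  have hspan : Submodule.map (Ideal.Quotient.mkₐ K I).toLinearMap
      (restrictTotalDegree (Fin n) K s) = Submodule.span K (Set.range
      (fun a : {a : staircase I // (a : Fin n →₀ ℕ).degree ≤ s} => staircaseBasis I a)) := by
    refine le_antisymm ?_ (Submodule.span_le.mpr ?_)
    · rintro _ ⟨f, hf, rfl⟩
      exact mk_mem_span_staircase I ((mem_restrictTotalDegree _ _ _).mp hf)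
    · rintro _ ⟨a, rfl⟩
      refine ⟨monomial (a : Fin n →₀ ℕ) 1, ?_, (staircaseBasis_apply I a).symm⟩
      refine (mem_restrictTotalDegree _ _ _).mpr ((totalDegree_monomial_le _ _).trans ?_)
      exact a.2
  have hli : LinearIndependent K
      (fun a : {a : staircase I // (a : Fin n →₀ ℕ).degree ≤ s} => staircaseBasis I a) :=
    (staircaseBasis I).linearIndependent.comp _ Subtype.val_injective
  rw [hilbertFunction, hspan, Module.finrank_eq_nat_card_basis (Module.Basis.span hli),
    ← Nat.card_coe_set_eq]
  exact Nat.card_congr (Equiv.subtypeSubtypeEquivSubtypeInter (fun a => a ∈ staircase I)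
    fun a => a.degree ≤ s)

theorem coeff_hilbertSeries {n : ℕ} {I : Ideal (MvPolynomial (Fin n) K)}
    (hfin : (staircase I).Finite) (s : ℕ) :
    PowerSeries.coeff s (hilbertSeries I) =
      ({a | a ∈ staircase I ∧ a.degree = s}.ncard : ℤ) := by
  rw [hilbertSeries, PowerSeries.coeff_mk, hilbertFunction_eq_ncard]
  cases s with
  | zero => simp
  | succ s =>
    rw [if_neg s.succ_ne_zero, Nat.add_sub_cancel, hilbertFunction_eq_ncard]
    have hunion : {a | a ∈ staircase I ∧ a.degree ≤ s + 1} =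
        {a | a ∈ staircase I ∧ a.degree ≤ s} ∪ {a | a ∈ staircase I ∧ a.degree = s + 1} := by
      ext a
      simp only [Set.mem_ofPred_eq, Set.mem_union, Nat.le_succ_iff]
      tauto
    rw [hunion, Set.ncard_union_eq _ (hfin.subset fun a h => h.1) (hfin.subset fun a h => h.1)]
    · push_cast
      ring
    · refine Set.disjoint_left.mpr fun a h1 h2 => ?_
      have := h1.2
      have := h2.2
      omega

/-! ### The ideal of highest-degree components -/

/-- Degree-`s` parts of elements of `I` of degree at most `s` are closed under addition and scalars,
and multiplication by a variable carries level `s` to level `s + 1`. They therefore already exhaust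
the degree-`s` part of the ideal generated by the top forms. -/
theorem exists_mem_coeff_eq_of_mem_topIdeal {n : ℕ} {I : Ideal (MvPolynomial (Fin n) K)}
    {j : MvPolynomial (Fin n) K} (hj : j ∈ topIdeal I) (s : ℕ) :
    ∃ f ∈ I, (∀ a, s < a.degree → coeff a f = 0) ∧
      ∀ a, a.degree = s → coeff a f = coeff a j := by
  classical
  induction hj using Submodule.span_induction generalizing s with
  | mem x hx =>
    obtain ⟨f, hf, rfl⟩ := hx
    by_cases hs : s = f.totalDegree
    · refine ⟨f, hf, fun a ha => coeff_eq_zero_of_totalDegree_lt (hs ▸ ha), fun a ha => ?_⟩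
      simp [coeff_homogeneousComponent, ha, hs]
    · refine ⟨0, I.zero_mem, by simp, fun a ha => ?_⟩
      simp [coeff_homogeneousComponent, ha, hs]
  | zero => exact ⟨0, I.zero_mem, by simp, by simp⟩
  | add x y _ _ hx hy =>
    obtain ⟨f, hf, hf1, hf2⟩ := hx s
    obtain ⟨g, hg, hg1, hg2⟩ := hy s
    exact ⟨f + g, I.add_mem hf hg, fun a ha => by simp [hf1 a ha, hg1 a ha],
      fun a ha => by simp [hf2 a ha, hg2 a ha]⟩
  | smul p x _ hx =>
    rw [smul_eq_mul]
    induction p using MvPolynomial.induction_on generalizing s with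
    | C c =>
      obtain ⟨f, hf, hf1, hf2⟩ := hx s
      exact ⟨C c * f, I.mul_mem_left _ hf, fun a ha => by simp [hf1 a ha],
        fun a ha => by simp [hf2 a ha]⟩
    | add p q hp hq =>
      obtain ⟨f, hf, hf1, hf2⟩ := hp s
      obtain ⟨g, hg, hg1, hg2⟩ := hq s
      exact ⟨f + g, I.add_mem hf hg, fun a ha => by simp [hf1 a ha, hg1 a ha],
        fun a ha => by simp [add_mul, hf2 a ha, hg2 a ha]⟩
    | mul_X p i hp =>
      have hdeg : ∀ a : Fin n →₀ ℕ, i ∈ a.support →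
          (a - Finsupp.single i 1).degree + 1 = a.degree := by
        intro a ha
        have h1 : Finsupp.single i 1 ≤ a := by
          rw [Finsupp.single_le_iff]
          have := Finsupp.mem_support_iff.mp ha
          omega
        conv_rhs => rw [← tsub_add_cancel_of_le h1]
        simp
      cases s with
      | zero =>
        refine ⟨0, I.zero_mem, by simp, fun a ha => ?_⟩
        -- No monomial of degree `0` is divisible by `X i`.
        rw [mul_right_comm, coeff_mul_X', if_neg, coeff_zero]
        intro hi
        have := hdeg a hi
        omega
      | succ s =>
        obtain ⟨f, hf, hf1, hf2⟩ := hp s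
        refine ⟨f * X i, I.mul_mem_right _ hf, fun a ha => ?_, fun a ha => ?_⟩
        · rw [coeff_mul_X']
          split_ifs with hi
          · exact hf1 _ (by have := hdeg a hi; omega)
          · rfl
        · rw [mul_right_comm, coeff_mul_X', coeff_mul_X']
          split_ifs with hi
          · exact hf2 _ (by have := hdeg a hi; omega)
          · rfl

theorem homogeneousComponent_totalDegree_mem_topIdeal {n : ℕ}
    {I : Ideal (MvPolynomial (Fin n) K)} {f : MvPolynomial (Fin n) K} (hf : f ∈ I) :
    homogeneousComponent f.totalDegree f ∈ topIdeal I :=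
  Ideal.subset_span ⟨f, hf, rfl⟩

theorem coeff_degree_homogeneousComponent_totalDegree {n : ℕ} (f : MvPolynomial (Fin n) K) :
    coeff ((drl n).degree f) (homogeneousComponent f.totalDegree f) =
      coeff ((drl n).degree f) f := by
  rw [coeff_homogeneousComponent, if_pos (totalDegree_eq_degree_drl f).symm]

theorem degree_homogeneousComponent_totalDegree {n : ℕ} {f : MvPolynomial (Fin n) K}
    (hf : f ≠ 0) :
    (drl n).degree (homogeneousComponent f.totalDegree f) = (drl n).degree f := by
  refine degree_eq_of_forall_le _ ?_ fun b hb => ?_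
  · rw [coeff_degree_homogeneousComponent_totalDegree]
    exact (drl n).coeff_degree_ne_zero_iff.mpr hf
  · rw [coeff_homogeneousComponent] at hb
    split_ifs at hb
    · exact (drl n).le_degree (mem_support_iff.mpr hb)
    · exact absurd rfl hb

/-- For the degree reverse lexicographic order, adding the last variable to the ideal of
highest-degree components cuts out the monomials of the staircase free of that variable. -/
theorem staircase_topIdeal_sup_X {N : ℕ} (I : Ideal (MvPolynomial (Fin (N + 1)) K)) :
    staircase (topIdeal I ⊔ Ideal.span {X (Fin.last N)}) =
      {a | a ∈ staircase I ∧ a (Fin.last N) = 0} := by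
  classical
  ext a
  constructor
  · intro ha
    refine ⟨fun f hf hf0 hle => ?_, ?_⟩
    · refine ha _ (Ideal.mem_sup_left (homogeneousComponent_totalDegree_mem_topIdeal hf)) ?_
        ((degree_homogeneousComponent_totalDegree hf0).le.trans hle)
      intro h0
      refine (drl _).coeff_degree_ne_zero_iff.mpr hf0 ?_
      rw [← coeff_degree_homogeneousComponent_totalDegree, h0, coeff_zero]
    · by_contra hlast
      refine ha _ (Ideal.mem_sup_right (Ideal.subset_span rfl)) (X_ne_zero _) ?_
      rw [(drl _).degree_X, Finsupp.single_le_iff]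
      omega
  · rintro ⟨ha, hlast⟩ f hf hf0 hle
    obtain ⟨j, hj, x, hx, rfl⟩ := Submodule.mem_sup.mp hf
    obtain ⟨h, rfl⟩ := Ideal.mem_span_singleton'.mp hx
    -- As a divisor of `a`, the monomial `b` is free of `x_n`, so its coefficient comes from `j`
    -- alone.
    set b := (drl (N + 1)).degree (j + h * X (Fin.last N)) with hb
    have hb0 : b (Fin.last N) = 0 := by
      have := hle (Fin.last N)
      omega
    have hXcoeff : ∀ c : Fin (N + 1) →₀ ℕ, c (Fin.last N) = 0 →
        coeff c (h * X (Fin.last N)) = 0 := by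
      intro c hc
      rw [coeff_mul_X', if_neg (by simpa using hc)]
    have hbj : coeff b j ≠ 0 := by
      have := (drl (N + 1)).coeff_degree_ne_zero_iff.mpr hf0
      rwa [← hb, coeff_add, hXcoeff b hb0, add_zero] at this
    obtain ⟨g, hg, hg1, hg2⟩ := exists_mem_coeff_eq_of_mem_topIdeal hj b.degree
    have hgb : coeff b g ≠ 0 := by rwa [hg2 b rfl]
    -- In degree `b.degree`, terms of `g` divisible by `x_n` lie below `b` by DRL; the others also
    -- occur in `j + h * x_n`, whose leading monomial is `b`.
    have hdeg : (drl (N + 1)).degree g = b := by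
      refine degree_eq_of_forall_le _ hgb fun c hc => ?_
      rcases lt_trichotomy c.degree b.degree with hlt | heq | hgt
      · exact le_of_lt ((drl_lt_iff _ _).mpr (Or.inl hlt))
      · by_cases hc0 : c (Fin.last N) = 0
        · refine (drl (N + 1)).le_degree (mem_support_iff.mpr ?_)
          rwa [coeff_add, hXcoeff c hc0, add_zero, ← hg2 c heq]
        · exact le_of_lt (drl_lt_of_last heq hc0 hb0)
      · exact absurd (hg1 c hgt) hc
    refine ha g hg ?_ (hdeg.le.trans hle)
    rintro rfl
    exact hgb (coeff_zero _)

/-! ### Finiteness from shape position -/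

/-- The relations `x_i = g_i(x_n)` make the class of `x_n` generate the quotient algebra, and the
monic `q` makes it integral. -/
theorem staircase_finite_of_isShapePosition {N : ℕ} {I : Ideal (MvPolynomial (Fin (N + 1)) K)}
    (hI : IsShapePosition I) : (staircase I).Finite := by
  obtain ⟨g, q, hq, hG, -⟩ := hI
  set x : MvPolynomial (Fin (N + 1)) K ⧸ I := Ideal.Quotient.mkₐ K I (X (Fin.last N)) with hx
  have hint : IsIntegral K x := by
    refine ⟨q, hq, ?_⟩
    rw [← Polynomial.aeval_def, hx, Polynomial.aeval_algHom_apply]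
    exact Ideal.Quotient.eq_zero_iff_mem.mpr (hG (Or.inr rfl))
  have hX : ∀ i, Ideal.Quotient.mkₐ K I (X i) ∈ Algebra.adjoin K {x} := by
    intro i
    refine Fin.lastCases ?_ (fun i => ?_) i
    · exact Algebra.subset_adjoin rfl
    · have : Ideal.Quotient.mkₐ K I (X i.castSucc) = Polynomial.aeval x (g i) := by
        rw [hx, Polynomial.aeval_algHom_apply]
        exact Ideal.Quotient.eq.mpr (hG (Or.inl ⟨i, rfl⟩))
      rw [this]
      exact Polynomial.aeval_mem_adjoin_singleton _ _
  have htop : Algebra.adjoin K {x} = ⊤ := by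
    refine eq_top_iff.mpr ?_
    rw [← (AlgHom.range_eq_top _).mpr (Ideal.Quotient.mkₐ_surjective K I), ← Algebra.map_top,
      ← MvPolynomial.adjoin_range_X, AlgHom.map_adjoin]
    refine Algebra.adjoin_le ?_
    rintro _ ⟨_, ⟨i, rfl⟩, rfl⟩
    exact hX i
  have : Module.Finite K (MvPolynomial (Fin (N + 1)) K ⧸ I) := by
    refine ⟨?_⟩
    rw [← Algebra.top_toSubmodule, ← htop]
    exact hint.fg_adjoin_singleton
  have : Finite (staircase I) := Module.Finite.finite_basis (staircaseBasis I)
  exact Set.toFinite _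

/-! ### Counting the non-trivial columns -/

theorem isTrivialColumn_iff {N : ℕ} {I : Ideal (MvPolynomial (Fin (N + 1)) K)}
    (b : staircase I) :
    IsTrivialColumn I b ↔
      (b : Fin (N + 1) →₀ ℕ) + Finsupp.single (Fin.last N) 1 ∈ staircase I := by
  refine ⟨fun ⟨c, hc, _⟩ => hc ▸ c.2, fun h => ⟨⟨_, h⟩, rfl, fun r => ?_⟩⟩
  have : Ideal.Quotient.mk I (X (Fin.last N)) * staircaseBasis I b =
      staircaseBasis I ⟨_, h⟩ := by
    rw [staircaseBasis_apply, staircaseBasis_apply, ← map_mul, X, monomial_mul, mul_one,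
      add_comm (Finsupp.single _ _)]
  rw [multMatrix, this, Module.Basis.repr_self]

/-- Both sets are complements in the finite set `E`: of the `b` with `x_n b ∈ E`, and of the image
of these `b` under multiplication by `x_n`. The bijection thus concerns the complements. -/
theorem ncard_not_isTrivialColumn {N : ℕ} {I : Ideal (MvPolynomial (Fin (N + 1)) K)}
    (hfin : (staircase I).Finite) :
    {b : staircase I | ¬ IsTrivialColumn I b}.ncard =
      {a | a ∈ staircase I ∧ a (Fin.last N) = 0}.ncard := by
  set e : Fin (N + 1) →₀ ℕ := Finsupp.single (Fin.last N) 1 with he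
  have h1 : {b : staircase I | ¬ IsTrivialColumn I b}.ncard =
      (staircase I \ {b | b ∈ staircase I ∧ b + e ∈ staircase I}).ncard := by
    rw [← Set.ncard_image_of_injective _ Subtype.val_injective]
    congr 1
    ext b
    simp [isTrivialColumn_iff, he]
    tauto
  have h2 : {a | a ∈ staircase I ∧ a (Fin.last N) = 0} =
      staircase I \ ((· + e) '' {b | b ∈ staircase I ∧ b + e ∈ staircase I}) := by
    ext a
    simp only [Set.mem_ofPred_eq, Set.mem_sdiff, Set.mem_image, not_exists, not_and]
    refine and_congr_right fun ha => ⟨fun h0 b _ hba => ?_, fun h => ?_⟩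
    · rw [← hba] at h0
      simp [he] at h0
    · by_contra h0
      have hle : e ≤ a := by
        rw [he, Finsupp.single_le_iff]
        omega
      refine h (a - e) ⟨staircase_mem_of_le ha tsub_le_self, ?_⟩ (tsub_add_cancel_of_le hle)
      rwa [tsub_add_cancel_of_le hle]
  rw [h1, h2, Set.ncard_sdiff (fun b hb => hb.1) (hfin.subset fun b hb => hb.1),
    Set.ncard_sdiff (by rintro _ ⟨b, hb, rfl⟩; exact hb.2)
      ((hfin.subset fun b hb => hb.1).image _),
    Set.ncard_image_of_injective _ (add_left_injective e)]

/-- Dividing by the last variable embeds the part of degree `s + 1` of the staircase divisible by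
that variable into the part of degree `s`. -/
theorem ncard_staircase_degree_succ_le {N : ℕ} {I : Ideal (MvPolynomial (Fin (N + 1)) K)}
    (hfin : (staircase I).Finite) (s : ℕ) :
    {a | a ∈ staircase I ∧ a.degree = s + 1}.ncard ≤
      {a | a ∈ staircase I ∧ a.degree = s}.ncard +
        {a | (a ∈ staircase I ∧ a (Fin.last N) = 0) ∧ a.degree = s + 1}.ncard := by
  set e : Fin (N + 1) →₀ ℕ := Finsupp.single (Fin.last N) 1 with he
  rw [← Set.ncard_image_of_injective {a | a ∈ staircase I ∧ a.degree = s} (add_left_injective e)]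
  refine (Set.ncard_le_ncard ?_ ?_).trans (Set.ncard_union_le _ _)
  · rintro a ⟨ha, hdeg⟩
    by_cases h0 : a (Fin.last N) = 0
    · exact Or.inr ⟨⟨ha, h0⟩, hdeg⟩
    · have hle : e ≤ a := by
        rw [he, Finsupp.single_le_iff]
        omega
      have hae := tsub_add_cancel_of_le hle
      refine Or.inl ⟨a - e, ⟨staircase_mem_of_le ha tsub_le_self, ?_⟩, hae⟩
      have : (a - e).degree + 1 = a.degree := by
        conv_rhs => rw [← hae]
        simp [he]
      omega
  · exact ((hfin.subset fun a h => h.1).image _).union (hfin.subset fun a h => h.1.1)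

theorem sum_ncard_degree_eq {n : ℕ} {S : Set (Fin n →₀ ℕ)} {M : ℕ} (hfin : S.Finite)
    (hM : ∀ a ∈ S, a.degree < M) :
    ∑ k ∈ Finset.range M, {a | a ∈ S ∧ a.degree = k}.ncard = S.ncard := by
  classical
  lift S to Finset (Fin n →₀ ℕ) using hfin
  rw [Set.ncard_coe_finset, Finset.card_eq_sum_card_fiberwise
    (f := fun a => a.degree) (t := Finset.range M) (fun a ha => by simpa using hM a ha)]
  refine Finset.sum_congr rfl fun k _ => ?_
  rw [← Set.ncard_coe_finset]
  congr 1
  ext a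
  simp

/-! ### The peak of a sequence -/

/-- If `q` is the sequence of differences of `h`, truncated at its first non-positive entry, and
bounds these differences from above, then the sum of `q` is the largest value of `h`. -/
theorem isGreatest_sum_of_truncated_differences {h q : ℕ → ℤ} {M : ℕ}
    (hnonneg : ∀ k, 0 ≤ h k) (hM : ∀ k, M ≤ k → h k = 0)
    (hstep0 : h 0 ≤ q 0) (hstep : ∀ k, h (k + 1) ≤ h k + q (k + 1))
    (hpos : ∀ k, (∀ j ≤ k, 0 < h j - if j = 0 then 0 else h (j - 1)) →
      q k = h k - if k = 0 then 0 else h (k - 1))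
    (hneg : ∀ k, (¬ ∀ j ≤ k, 0 < h j - if j = 0 then 0 else h (j - 1)) → q k = 0) :
    IsGreatest (Set.range h) (∑ k ∈ Finset.range M, q k) := by
  classical
  set c : ℕ → ℤ := fun j => h j - if j = 0 then 0 else h (j - 1) with hc
  -- At `M` the difference is `-h (M - 1)`, or `0` when `M = 0`.
  have hex : ∃ m, c m ≤ 0 := ⟨M, by
    simp only [hc, hM M le_rfl]
    split_ifs
    · simp
    · linarith [hnonneg (M - 1)]⟩
  obtain ⟨m, hm, hmin⟩ : ∃ m, c m ≤ 0 ∧ ∀ j < m, 0 < c j :=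
    ⟨Nat.find hex, Nat.find_spec hex, fun j hj => not_le.mp (Nat.find_min hex hj)⟩
  have hmM : m ≤ M := by
    by_contra! hlt
    have := hmin M hlt
    simp only [hc, hM M le_rfl] at this
    split_ifs at this
    · simp at this
    · linarith [hnonneg (M - 1)]
  have hq1 : ∀ k < m, q k = c k := fun k hk => hpos k fun j hj => hmin j (hj.trans_lt hk)
  have hq0 : ∀ k, m ≤ k → q k = 0 := fun k hk => hneg k fun hall =>
    absurd (hall m hk) (not_lt.mpr hm)
  -- The shift by one puts `h_{-1} = 0` at index `0`, so that the differences telescope uniformly.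
  set h' : ℕ → ℤ := fun k => if k = 0 then 0 else h (k - 1) with hh'
  have hcdiff : ∀ k, c k = h' (k + 1) - h' k := fun k => by simp [hc, hh']
  have hsum : ∑ k ∈ Finset.range M, q k = h' m := by
    rw [← Finset.sum_subset (Finset.range_subset_range.mpr hmM)
        fun k _ hk => hq0 k (by simpa using hk),
      Finset.sum_congr rfl fun k hk => (hq1 k (Finset.mem_range.mp hk)).trans (hcdiff k),
      Finset.sum_range_sub]
    simp [hh']
  have hup : ∀ k, k ≤ m → h' k ≤ h' m := fun k hk => by
    induction hk using Nat.decreasingInduction with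
    | self => exact le_rfl
    | of_succ k hk ih =>
      have := hmin k hk
      rw [hcdiff] at this
      linarith
  have hdown : ∀ k, m ≤ k → h' k ≤ h' m := fun k hk => by
    induction k, hk using Nat.le_induction with
    | base => exact le_rfl
    | succ k hk ih =>
      have h0 := hq0 k hk
      refine le_trans ?_ ih
      cases k with
      | zero => simpa [hh', h0] using hstep0
      | succ k => simpa [hh', h0] using hstep k
  rw [hsum]
  refine ⟨?_, ?_⟩
  · cases m with
    -- If `m = 0`, the claimed maximum is the empty sum `0`; it is attained because `h 0` vanishes.
    | zero =>
      refine ⟨0, le_antisymm ?_ ?_⟩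
      · simpa [hh'] using hdown 1 (Nat.zero_le 1)
      · simpa [hh'] using hnonneg 0
    | succ m => exact ⟨m, by simp [hh']⟩
  · rintro _ ⟨k, rfl⟩
    have : h k = h' (k + 1) := by simp [hh']
    rw [this]
    rcases le_total (k + 1) m with hk | hk
    · exact hup _ hk
    · exact hdown _ hk

theorem coeff_one_sub_X_mul (H : PowerSeries ℤ) (k : ℕ) :
    PowerSeries.coeff k ((1 - PowerSeries.X) * H) =
      PowerSeries.coeff k H - if k = 0 then 0 else PowerSeries.coeff (k - 1) H := by
  rw [sub_mul, one_mul, map_sub]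
  cases k with
  | zero => simp
  | succ k => simp [PowerSeries.coeff_succ_X_mul]

end

end DetIdeal

theorem mainTheorem5 {K : Type*} [Field K] [Infinite K] {N p d : ℕ}
    (hp : 1 ≤ p) (hpn : p < N + 1) (hd : 1 ≤ d)
    (I : Ideal (MvPolynomial (Fin (N + 1)) K))
    (hI : DetIdeal.IsGenericDeterminantal p d I) :
    (DetIdeal.staircase I).Finite ∧
      IsGreatest
        (Set.range fun k : ℕ => PowerSeries.coeff k (DetIdeal.hilbertSeries I))
        (({b : DetIdeal.staircase I | ¬ DetIdeal.IsTrivialColumn I b}.ncard : ℕ) : ℤ) := by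
  have hfin := DetIdeal.staircase_finite_of_isShapePosition hI.shape
  refine ⟨hfin, ?_⟩
  set J := DetIdeal.topIdeal I ⊔ Ideal.span {MvPolynomial.X (Fin.last N)} with hJ
  have hJE : DetIdeal.staircase J = _ := DetIdeal.staircase_topIdeal_sup_X I
  have hJfin : (DetIdeal.staircase J).Finite := hJE ▸ hfin.subset fun a h => h.1
  obtain ⟨M, hM⟩ : ∃ M, ∀ a ∈ DetIdeal.staircase I, a.degree < M := by
    obtain ⟨B, hB⟩ := (hfin.image Finsupp.degree).bddAbove
    exact ⟨B + 1, fun a ha => Nat.lt_succ_of_le (hB ⟨a, ha, rfl⟩)⟩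
  have hfroberg : ∀ k, PowerSeries.coeff k (DetIdeal.hilbertSeries J) =
      PowerSeries.coeff k
        (DetIdeal.truncPos ((1 - PowerSeries.X) * DetIdeal.hilbertSeries I)) := fun k => by
    have := hI.froberg 1 le_rfl
    rw [DetIdeal.hilbertSeriesQuot, pow_one, pow_one] at this
    rw [hJ, this]
  have hsum := DetIdeal.sum_ncard_degree_eq hJfin
    (fun a ha => hM a (by rw [hJE] at ha; exact ha.1))
  rw [DetIdeal.ncard_not_isTrivialColumn hfin, ← hJE, ← hsum, Nat.cast_sum,
    ← Finset.sum_congr rfl fun k _ => DetIdeal.coeff_hilbertSeries hJfin k]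
  refine DetIdeal.isGreatest_sum_of_truncated_differences (fun k => ?_) (fun k hk => ?_) ?_
    (fun k => ?_) (fun k hk => ?_) (fun k hk => ?_)
  · rw [DetIdeal.coeff_hilbertSeries hfin]
    exact Nat.cast_nonneg _
  · rw [DetIdeal.coeff_hilbertSeries hfin, Nat.cast_eq_zero,
      Set.ncard_eq_zero (hfin.subset fun a h => h.1)]
    refine Set.eq_empty_of_forall_notMem fun a ha => ?_
    have := hM a ha.1
    have := ha.2
    omega
  -- The only monomial of degree `0` is `1`, which is free of `x_n`.
  · rw [DetIdeal.coeff_hilbertSeries hfin, DetIdeal.coeff_hilbertSeries hJfin, hJE]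
    refine Nat.cast_le.mpr (Set.ncard_le_ncard ?_ (hfin.subset fun a h => h.1.1))
    rintro a ⟨ha, hdeg⟩
    have : a = 0 := (Finsupp.degree_eq_zero_iff a).mp hdeg
    exact ⟨⟨ha, by simp [this]⟩, hdeg⟩
  · rw [DetIdeal.coeff_hilbertSeries hfin, DetIdeal.coeff_hilbertSeries hfin,
      DetIdeal.coeff_hilbertSeries hJfin, hJE]
    exact_mod_cast DetIdeal.ncard_staircase_degree_succ_le hfin k
  · rw [hfroberg, DetIdeal.truncPos, PowerSeries.coeff_mk, if_pos,
      DetIdeal.coeff_one_sub_X_mul]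
    intro j hj
    rw [DetIdeal.coeff_one_sub_X_mul]
    exact hk j hj
  · rw [hfroberg, DetIdeal.truncPos, PowerSeries.coeff_mk, if_neg]
    simpa only [DetIdeal.coeff_one_sub_X_mul] using hk
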